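/- Let $I=[0,1]$ and let $\mathrm{Diff}^{\omega}_{+}(I)$ be the group, under composition, of orientation-preserving analytic diffeomorphisms of $I$, that is, of increasing bijections $f:I\to I$ such that each of $f$ and $f^{-1}$ is the restriction to $I$ of a function that is real-analytic on a neighbourhood of $I$ in $\mathbb{R}$. A subgroup $G\le \mathrm{Diff}^{\omega}_{+}(I)$ is called $C^0$-discrete if it is a discrete set for the metric $d(f,g)=\sup_{x\in I}|f(x)-g(x)|$, that is, for every $f\in G$ there is $\varepsilon>0$ such that no $g\in G\setminus\{f\}$ satisfies $d(f,g)<\varepsilon$. Let $\Gamma\le \mathrm{Diff}^{\omega}_{+}(I)$ be a non-abelian subgroup. Then: 1. if $\Gamma$ has a nontrivial abelian normal subgroup, then $\Gamma$ is not $C^0$-discrete; 2. no nontrivial abelian normal subgroup $N$ of $\Gamma$ is $C^0$-discrete; 3. in particular, if $\Gamma$ is solvable, then $\Gamma$ is not $C^0$-discrete. -/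

import Mathlib

open scoped unitInterval

/-- A self-map of the closed interval `I = [0,1]` is (real-)analytic, up to and including the
endpoints, if it is the restriction of a function that is analytic on a neighbourhood
of `[0,1]` in `ℝ`. -/
def IsAnalyticOnI (f : I → I) : Prop :=
  ∃ F : ℝ → ℝ, AnalyticOnNhd ℝ F (Set.Icc 0 1) ∧ ∀ x : I, F (x : ℝ) = (f x : ℝ)

theorem IsAnalyticOnI.id : IsAnalyticOnI (fun x => x) :=
  ⟨fun x => x, analyticOnNhd_id, fun _ => rfl⟩

theorem IsAnalyticOnI.comp {f g : I → I} (hf : IsAnalyticOnI f) (hg : IsAnalyticOnI g) :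
    IsAnalyticOnI (fun x => f (g x)) := by
  obtain ⟨F, hF, hFf⟩ := hf
  obtain ⟨G, hG, hGg⟩ := hg
  refine ⟨F ∘ G, hF.comp hG ?_, fun x => ?_⟩
  · intro x hx
    have h := hGg ⟨x, hx⟩
    simp only at h
    rw [h]
    exact (g ⟨x, hx⟩).2
  · rw [Function.comp_apply, hGg, hFf]

/-- The group `Diff^ω₊(I)` of orientation-preserving analytic diffeomorphisms of `I = [0,1]`
(analytic maps with an analytic inverse), as a subgroup of the group of homeomorphisms of `I`
under composition. -/
def analyticDiffPlus : Subgroup (I ≃ₜ I) where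
  carrier := {f | StrictMono f ∧ IsAnalyticOnI f ∧ IsAnalyticOnI f.symm}
  mul_mem' := by
    rintro f g ⟨hf, hf₁, hf₂⟩ ⟨hg, hg₁, hg₂⟩
    exact ⟨hf.comp hg, hf₁.comp hg₁, hg₂.comp hf₂⟩
  one_mem' := ⟨strictMono_id, IsAnalyticOnI.id, IsAnalyticOnI.id⟩
  inv_mem' := by
    rintro f ⟨hf, hf₁, hf₂⟩
    refine ⟨fun x y hxy => ?_, hf₂, hf₁⟩
    have h : f (f.symm x) < f (f.symm y) := by simpa using hxy
    exact hf.lt_iff_lt.1 h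

/-- The `C⁰`-metric `sup_{x ∈ I} |f x - g x|` on homeomorphisms of `I`
(the distance of the Mathlib metric space `C(I, I)`). -/
noncomputable def c0Dist (f g : I ≃ₜ I) : ℝ :=
  dist (⟨f, f.continuous⟩ : C(I, I)) (⟨g, g.continuous⟩ : C(I, I))

/-- A group of homeomorphisms of `I` is `C⁰`-discrete if each of its elements is isolated in it
for the `C⁰`-metric. -/
def IsC0Discrete (G : Subgroup (I ≃ₜ I)) : Prop :=
  ∀ f ∈ G, ∃ ε : ℝ, 0 < ε ∧ ∀ g ∈ G, c0Dist f g < ε → g = f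

/-! Take `f ≠ 1` in the abelian normal subgroup `N`. By analyticity a nontrivial map has finitely
many fixed points and a finite order of contact with the identity at each. Centralizers of
nontrivial maps are abelian (`commute_of_commute`), so some `g ∈ Γ` does not commute with `f`. It
fixes every fixed point of `f`, and there all of `N` is tangent to the identity. The commutator of
`g` and `f` is a nontrivial element of `N`. Commuting maps tangent to the identity have the same
order of contact (`not_coefAt_zero_of_commute`), so the commutator is not flatter than `f` at `0`;
this forces `g'(0) ≠ 1`, and `μ = g'(0) > 1` after possibly inverting `g`.

Near `0` the conjugates `g ^ n * f * (g ^ n)⁻¹` then tend to the identity: pulling back by `g ^ n`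
makes the displacement of `f` of size about `μ ^ (-2n)`, and pushing forward expands it only by
about `μ ^ n`. Commutation with `f` spreads the convergence over the gap up to the next fixed point,
where the multiplier of `g` again exceeds `1` (`one_lt_multAt_of_gap`). Hence the convergence holds
on all of `I`, uniformly by monotonicity, and `1` is not isolated in `N`. -/

open Filter Topology

/-! ### Multipliers and leading coefficients at a fixed point -/

/-- The map `f - id` vanishes at `p` like `a * (x - p) ^ k`. -/
def CoefAt (f : I ≃ₜ I) (p : I) (k : ℕ) (a : ℝ) : Prop :=
  Tendsto (fun x : I => ((f x : ℝ) - x) / ((x : ℝ) - p) ^ k) (𝓝[≠] p) (𝓝 a)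

/-- `f` extends to a function on `ℝ` that is strictly differentiable at `p` with derivative `μ`. -/
def MultAt (f : I ≃ₜ I) (p : I) (μ : ℝ) : Prop :=
  ∃ F : ℝ → ℝ, HasStrictDerivAt F μ p ∧ ∀ x : I, F x = f x

theorem tendsto_coe_punctured (p : I) :
    Tendsto (fun x : I => (x : ℝ)) (𝓝[≠] p) (𝓝[≠] (p : ℝ)) :=
  tendsto_nhdsWithin_of_tendsto_nhds_of_eventually_within _
    (continuous_subtype_val.continuousAt.tendsto.mono_left nhdsWithin_le_nhds)
    (eventually_mem_nhdsWithin.mono fun _ hx h => hx (Subtype.ext h))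

theorem eventually_sub_ne_zero (p : I) : ∀ᶠ x : I in 𝓝[≠] p, (x : ℝ) - p ≠ 0 :=
  eventually_mem_nhdsWithin.mono fun _ hx h => hx (Subtype.ext (sub_eq_zero.1 h))

theorem tendsto_punctured {f : I ≃ₜ I} {p : I} (hp : f p = p) :
    Tendsto f (𝓝[≠] p) (𝓝[≠] p) := by
  have h := (f.map_punctured_nhds_eq p).le
  rwa [hp] at h

theorem tendsto_pow_sub (p : I) {k : ℕ} (hk : 1 ≤ k) :
    Tendsto (fun x : I => ((x : ℝ) - p) ^ k) (𝓝[≠] p) (𝓝 0) := by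
  have h : Tendsto (fun x : I => ((x : ℝ) - p) ^ k) (𝓝 p) (𝓝 (((p : ℝ) - p) ^ k)) :=
    Continuous.tendsto (by fun_prop) p
  rw [sub_self, zero_pow (by omega)] at h
  exact h.mono_left nhdsWithin_le_nhds

theorem inv_fix {f : I ≃ₜ I} {p : I} (hp : f p = p) : (f⁻¹) p = p := by
  conv_lhs => rw [← hp]
  exact f.symm_apply_apply p

theorem mul_fix {f g : I ≃ₜ I} {p : I} (hf : f p = p) (hg : g p = p) : (f * g) p = p := by
  rw [Homeomorph.mul_apply, hg, hf]

theorem inv_apply_self' (f : I ≃ₜ I) (x : I) : (f⁻¹) (f x) = x := f.symm_apply_apply x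

theorem apply_inv_self' (f : I ≃ₜ I) (x : I) : f ((f⁻¹) x) = x := f.apply_symm_apply x

namespace MultAt

theorem tendsto {f : I ≃ₜ I} {p : I} {μ : ℝ} (h : MultAt f p μ) (hp : f p = p) :
    Tendsto (fun x : I => ((f x : ℝ) - p) / ((x : ℝ) - p)) (𝓝[≠] p) (𝓝 μ) := by
  obtain ⟨F, hF, hFf⟩ := h
  have h1 := (hasDerivAt_iff_tendsto_slope.1 hF.hasDerivAt).comp (tendsto_coe_punctured p)
  refine h1.congr fun x => ?_
  simp [slope_def_field, hFf, hp]

theorem unique {f : I ≃ₜ I} {p : I} {μ ν : ℝ} (h : MultAt f p μ) (h' : MultAt f p ν)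
    (hp : f p = p) : μ = ν :=
  tendsto_nhds_unique (h.tendsto hp) (h'.tendsto hp)

theorem mul {f g : I ≃ₜ I} {p : I} {μ ν : ℝ} (hf : MultAt f p μ) (hg : MultAt g p ν)
    (hp : g p = p) : MultAt (f * g) p (μ * ν) := by
  obtain ⟨F, hF, hFf⟩ := hf
  obtain ⟨G, hG, hGg⟩ := hg
  refine ⟨F ∘ G, ?_, fun x => ?_⟩
  · refine HasStrictDerivAt.comp (p : ℝ) ?_ hG
    rwa [hGg, hp]
  · rw [Function.comp_apply, hGg, hFf, Homeomorph.mul_apply]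

theorem one (p : I) : MultAt 1 p 1 := ⟨fun x => x, hasStrictDerivAt_id _, fun _ => rfl⟩

end MultAt

theorem fix_zero {f : I ≃ₜ I} (hf : StrictMono f) : f 0 = 0 := by
  refine le_antisymm ?_ bot_le
  have := hf.monotone (show (0 : I) ≤ f⁻¹ 0 from bot_le)
  rwa [apply_inv_self'] at this

theorem fix_one {f : I ≃ₜ I} (hf : StrictMono f) : f 1 = 1 := by
  refine le_antisymm le_top ?_
  have := hf.monotone (show f⁻¹ 1 ≤ (1 : I) from le_top)
  rwa [apply_inv_self'] at this

theorem exists_multAt {f : I ≃ₜ I} (hf : f ∈ analyticDiffPlus) {p : I} (hp : f p = p) :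
    ∃ μ, 0 < μ ∧ MultAt f p μ ∧ MultAt f⁻¹ p μ⁻¹ := by
  have key : ∀ g ∈ analyticDiffPlus, g p = p → ∃ μ, 0 ≤ μ ∧ MultAt g p μ := by
    rintro g ⟨hg, ⟨F, hF, hFg⟩, -⟩ hgp
    have hm : MultAt g p (deriv F p) := ⟨F, (hF p p.2).hasStrictDerivAt, hFg⟩
    refine ⟨_, ge_of_tendsto (hm.tendsto hgp) ?_, hm⟩
    refine eventually_mem_nhdsWithin.mono fun x hx => ?_
    rcases lt_or_gt_of_ne hx with h | h
    · have h2 := hg h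
      rw [hgp] at h2
      exact div_nonneg_of_nonpos (sub_nonpos.2 h2.le) (sub_nonpos.2 h.le)
    · have h2 := hg h
      rw [hgp] at h2
      exact div_nonneg (sub_nonneg.2 h2.le) (sub_nonneg.2 h.le)
  obtain ⟨μ, h0, hμ⟩ := key f hf hp
  obtain ⟨ν, h0', hν⟩ := key f⁻¹ (inv_mem hf) (inv_fix hp)
  have h1 := hμ.mul hν (inv_fix hp)
  rw [mul_inv_cancel] at h1
  have h2 : μ * ν = 1 := h1.unique (MultAt.one p) rfl
  refine ⟨μ, lt_of_le_of_ne h0 ?_, hμ, ?_⟩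
  · rintro rfl
    simp at h2
  · rwa [← eq_inv_of_mul_eq_one_right h2]

/-- This is where analyticity enters: by the identity theorem `f - id` has a zero of finite order at
`p`, of order `0` when `p` is not fixed. -/
theorem exists_coefAt {f : I ≃ₜ I} (hf : f ∈ analyticDiffPlus) (h1 : f ≠ 1) (p : I) :
    ∃ k a, a ≠ 0 ∧ CoefAt f p k a := by
  obtain ⟨-, ⟨F, hF, hFf⟩, -⟩ := hf
  have hD : AnalyticOnNhd ℝ (fun x => F x - x) (Set.Icc 0 1) :=
    hF.sub analyticOnNhd_id
  have hnz : ¬ ∀ᶠ z in 𝓝 (p : ℝ), F z - z = 0 := by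
    intro h
    have h2 := hD.eqOn_zero_of_preconnected_of_eventuallyEq_zero isPreconnected_Icc p.2 h
    refine h1 (Homeomorph.ext fun x => Subtype.ext ?_)
    have h3 := h2 x.2
    simp only [Pi.zero_apply, hFf, sub_eq_zero] at h3
    exact h3
  obtain ⟨k, e, he, he0, hev⟩ := (hD p p.2).exists_eventuallyEq_pow_smul_nonzero_iff.2 hnz
  refine ⟨k, e p, he0, ?_⟩
  have h2 : Tendsto (fun x : I => e x) (𝓝[≠] p) (𝓝 (e p)) :=
    he.continuousAt.tendsto.comp ((tendsto_coe_punctured p).mono_right nhdsWithin_le_nhds)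
  refine h2.congr' ?_
  have h3 := ((tendsto_coe_punctured p).mono_right nhdsWithin_le_nhds).eventually hev
  filter_upwards [h3, eventually_sub_ne_zero p] with x hx hx0
  rw [← hFf, hx, smul_eq_mul, mul_div_cancel_left₀ _ (pow_ne_zero _ hx0)]

namespace CoefAt

theorem unique {f : I ≃ₜ I} {p : I} {k : ℕ} {a b : ℝ} (h : CoefAt f p k a)
    (h' : CoefAt f p k b) : a = b :=
  tendsto_nhds_unique h h'

theorem eventually_ne {f : I ≃ₜ I} {p : I} {k : ℕ} {a : ℝ} (h : CoefAt f p k a) (ha : a ≠ 0) :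
    ∀ᶠ x in 𝓝[≠] p, f x ≠ x := by
  refine (Tendsto.eventually_ne h ha).mono fun x hx h => hx ?_
  simp [h]

theorem two_le {f : I ≃ₜ I} {p : I} {k : ℕ} {a : ℝ} (h : CoefAt f p k a) (ha : a ≠ 0)
    (hp : f p = p) (hm : MultAt f p 1) : 2 ≤ k := by
  by_contra! hk
  interval_cases k
  · refine ha (h.unique (b := 0) ?_)
    have : Tendsto (fun x : I => (f x : ℝ) - x) (𝓝 p) (𝓝 ((f p : ℝ) - p)) :=
      Continuous.tendsto (by fun_prop) p
    rw [hp, sub_self] at this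
    exact (this.mono_left nhdsWithin_le_nhds).congr fun x => by simp
  · refine ha (h.unique (b := 0) ?_)
    have := (hm.tendsto hp).sub_const 1
    rw [sub_self] at this
    refine this.congr' ?_
    filter_upwards [eventually_sub_ne_zero p] with x hx
    field_simp
    ring

theorem one (p : I) (k : ℕ) : CoefAt 1 p k 0 := by
  refine tendsto_const_nhds.congr fun x => ?_
  simp [Homeomorph.one_apply]

theorem mul {f g : I ≃ₜ I} {p : I} {k : ℕ} {a b : ℝ} (hf : CoefAt f p k a) (hg : CoefAt g p k b)
    (hp : g p = p) (hm : MultAt g p 1) : CoefAt (f * g) p k (a + b) := by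
  have h1 : Tendsto (fun x : I => ((f (g x) : ℝ) - g x) / ((g x : ℝ) - p) ^ k) (𝓝[≠] p) (𝓝 a) :=
    hf.comp (tendsto_punctured hp)
  have h2 := (h1.mul ((hm.tendsto hp).pow k)).add hg
  rw [one_pow, mul_one] at h2
  refine h2.congr' ?_
  filter_upwards [eventually_sub_ne_zero p,
    (tendsto_punctured hp).eventually (eventually_sub_ne_zero p)] with x hx hx2
  rw [Homeomorph.mul_apply, div_pow]
  field_simp
  ring

theorem inv {f : I ≃ₜ I} {p : I} {k : ℕ} {a : ℝ} (hf : CoefAt f p k a)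
    (hp : f p = p) (hm : MultAt f⁻¹ p 1) : CoefAt f⁻¹ p k (-a) := by
  have hp' := inv_fix hp
  have h1 := hf.comp (tendsto_punctured hp')
  have h2 := (h1.mul ((hm.tendsto hp').pow k)).neg
  rw [one_pow, mul_one] at h2
  refine h2.congr' ?_
  filter_upwards [eventually_sub_ne_zero p,
    (tendsto_punctured hp').eventually (eventually_sub_ne_zero p)] with x hx hx2
  simp only [Function.comp_apply, apply_inv_self', div_pow]
  field_simp
  ring

/-- With `y = g⁻¹ x`, the displacement at `x` is `g (f y) - g y ≈ μ * (f y - y) ≈ μ * a * (y - p) ^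
k`, and `y - p ≈ μ⁻¹ * (x - p)`. -/
theorem conj {f g : I ≃ₜ I} {p : I} {k : ℕ} {a μ : ℝ} (hf : CoefAt f p k a) (hfp : f p = p)
    (hgp : g p = p) (hm : MultAt g p μ) (hμ : 0 < μ) :
    CoefAt (g * f * g⁻¹) p k (a * μ / μ ^ k) := by
  have h1 := (hm.tendsto hgp).inv₀ hμ.ne'
  obtain ⟨G, hG, hGg⟩ := hm
  -- Strict differentiability is needed because neither `f y` nor `y` is the base point `p`.
  have h2 := hG.hasStrictFDerivAt.isLittleO
  have h3 : Tendsto (fun x : I => ((f x : ℝ), (x : ℝ))) (𝓝[≠] p) (𝓝 ((p : ℝ), (p : ℝ))) := by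
    have : Tendsto (fun x : I => ((f x : ℝ), (x : ℝ))) (𝓝 p) (𝓝 ((f p : ℝ), (p : ℝ))) :=
      Continuous.tendsto (by fun_prop) p
    rw [hfp] at this
    exact this.mono_left nhdsWithin_le_nhds
  have h4 := h2.comp_tendsto h3
  have h5 : (fun x : I => (f x : ℝ) - x) =O[𝓝[≠] p] fun x : I => ((x : ℝ) - p) ^ k := by
    refine Asymptotics.isBigO_of_div_tendsto_nhds ?_ a hf
    filter_upwards [eventually_sub_ne_zero p] with x hx hx2
    exact absurd hx2 (pow_ne_zero _ hx)
  have h6 := (h4.trans_isBigO h5).tendsto_div_nhds_zero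
  have h7 := ((h6.add (hf.mul_const μ)).mul (h1.pow k)).comp (tendsto_punctured (inv_fix hgp))
  have h8 : (0 + a * μ) * μ⁻¹ ^ k = a * μ / μ ^ k := by
    rw [zero_add, inv_pow, div_eq_mul_inv]
  rw [h8] at h7
  refine h7.congr' ?_
  have ht := tendsto_punctured (inv_fix hgp)
  filter_upwards [eventually_sub_ne_zero p, ht.eventually (eventually_sub_ne_zero p)] with x hx hx2
  simp only [Function.comp_apply, Homeomorph.mul_apply, apply_inv_self', hGg,
    ContinuousLinearMap.toSpanSingleton_apply, smul_eq_mul, inv_pow, div_pow]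
  field_simp
  ring

end CoefAt

/-! ### Fixed points and commutation -/

theorem finite_fix {f : I ≃ₜ I} (hf : f ∈ analyticDiffPlus) (h1 : f ≠ 1) :
    {x | f x = x}.Finite := by
  by_contra hinf
  obtain ⟨p, -, hp⟩ := Set.Infinite.exists_accPt_of_subset_isCompact hinf isCompact_univ
    (Set.subset_univ _)
  obtain ⟨k, a, ha, hc⟩ := exists_coefAt hf h1 p
  rw [accPt_iff_frequently_nhdsNE] at hp
  exact hp (hc.eventually_ne ha)

/-- The orbit of a moved point under an increasing map is strictly monotone, hence infinite. -/
theorem fix_of_mapsTo {s : Set I} (hs : s.Finite) {h : I → I} (hh : StrictMono h)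
    (hm : Set.MapsTo h s s) {p : I} (hp : p ∈ s) : h p = p := by
  by_contra hne
  have hinj : Function.Injective fun n => h^[n] p := by
    rcases lt_or_gt_of_ne hne with hlt | hlt
    · exact (hh.strictAnti_iterate_of_map_lt hlt).injective
    · exact (hh.strictMono_iterate_of_lt_map hlt).injective
  exact Set.infinite_range_of_injective hinj
    (hs.subset (Set.range_subset_iff.2 fun n => hm.iterate n hp))

theorem fix_of_commute {f h : I ≃ₜ I} (hf : f ∈ analyticDiffPlus) (h1 : f ≠ 1)
    (hh : StrictMono h) (hc : Commute f h) {p : I} (hp : f p = p) : h p = p := by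
  refine fix_of_mapsTo (finite_fix hf h1) hh (fun x hx => ?_) hp
  have : f (h x) = h (f x) := DFunLike.congr_fun hc.eq x
  change f (h x) = h x
  rw [this, hx]

theorem tangent_inv {f : I ≃ₜ I} (hf : f ∈ analyticDiffPlus) {p : I} (hp : f p = p)
    (hm : MultAt f p 1) : MultAt f⁻¹ p 1 := by
  obtain ⟨μ, -, h1, h2⟩ := exists_multAt hf hp
  rw [h1.unique hm hp, inv_one] at h2
  exact h2

/-- Analytic diffeomorphisms that fix `p` and are tangent to the identity at `p` to an order
greater than `k`. -/
def flatSubgroup (p : I) (k : ℕ) : Subgroup (I ≃ₜ I) where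
  carrier := {w | w ∈ analyticDiffPlus ∧ w p = p ∧ MultAt w p 1 ∧ CoefAt w p k 0}
  mul_mem' := by
    rintro f g ⟨hf, hfp, hf1, hfk⟩ ⟨hg, hgp, hg1, hgk⟩
    refine ⟨mul_mem hf hg, mul_fix hfp hgp, ?_, ?_⟩
    · simpa using hf1.mul hg1 hgp
    · simpa using hfk.mul hgk hgp hg1
  one_mem' := ⟨one_mem _, rfl, MultAt.one p, CoefAt.one p k⟩
  inv_mem' := by
    rintro f ⟨hf, hfp, hf1, hfk⟩
    refine ⟨inv_mem hf, inv_fix hfp, tangent_inv hf hfp hf1, ?_⟩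
    simpa using hfk.inv hfp (tangent_inv hf hfp hf1)

/-- A map commuting with a hyperbolic germ and tangent to the identity is the identity. -/
theorem eq_one_of_commute_hyperbolic {f v : I ≃ₜ I} {p : I} {μ : ℝ} (hμ : 0 < μ) (hμ1 : μ ≠ 1)
    (hv : v ∈ analyticDiffPlus) (hfp : f p = p) (hvp : v p = p) (hc : Commute f v)
    (hfm : MultAt f p μ) (hvm : MultAt v p 1) : v = 1 := by
  by_contra hne
  obtain ⟨k, b, hb, hk⟩ := exists_coefAt hv hne p
  have h2 := hk.two_le hb hvp hvm
  have h3 := hk.conj hvp hfp hfm hμ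
  -- Conjugation by `f` leaves `v` unchanged, so `b = b * μ / μ ^ k`; as `k ≥ 2`, this forces `μ =
  -- 1`.
  rw [hc.eq, mul_inv_cancel_right] at h3
  have h4 := hk.unique h3
  rw [eq_div_iff (by positivity)] at h4
  have h5 := mul_left_cancel₀ hb h4
  obtain ⟨j, rfl⟩ : ∃ j, k = j + 1 := ⟨k - 1, by omega⟩
  rw [pow_succ] at h5
  have h6 : μ ^ j = 1 := mul_right_cancel₀ hμ.ne' (by rw [h5, one_mul])
  exact hμ1 ((pow_eq_one_iff_of_nonneg hμ.le (by omega)).1 h6)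

/-! ### Dynamics on a gap between fixed points -/

/-- `p < q` are consecutive fixed points of `f`. -/
structure IsGap (f : I ≃ₜ I) (p q : I) : Prop where
  lt : p < q
  left : f p = p
  right : f q = q
  ne : ∀ x, p < x → x < q → f x ≠ x

theorem exists_isGap {f : I ≃ₜ I} (hf : StrictMono f) {x : I} (hx : f x ≠ x) :
    ∃ p q, IsGap f p q ∧ p < x ∧ x < q := by
  have hcl : IsClosed {y | f y = y} := isClosed_eq f.continuous continuous_id
  obtain ⟨p, ⟨hp, hpx⟩, hpm⟩ := (hcl.inter isClosed_Iic).isCompact.exists_isGreatest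
    (s := {y | f y = y} ∩ Set.Iic x) ⟨0, fix_zero hf, unitInterval.nonneg'⟩
  obtain ⟨q, ⟨hq, hqx⟩, hqm⟩ := (hcl.inter isClosed_Ici).isCompact.exists_isLeast
    (s := {y | f y = y} ∩ Set.Ici x) ⟨1, fix_one hf, unitInterval.le_one'⟩
  have hp' : p < x := lt_of_le_of_ne hpx (by rintro rfl; exact hx hp)
  have hq' : x < q := lt_of_le_of_ne hqx (by rintro rfl; exact hx hq)
  refine ⟨p, q, ⟨hp'.trans hq', hp, hq, fun y hy hy' h => ?_⟩, hp', hq'⟩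
  rcases le_total y x with hyx | hyx
  · exact hy.not_ge (hpm ⟨h, hyx⟩)
  · exact hy'.not_ge (hqm ⟨h, hyx⟩)

theorem exists_isGap_zero {f : I ≃ₜ I} (hf : f ∈ analyticDiffPlus) (h1 : f ≠ 1) :
    ∃ q, IsGap f 0 q := by
  obtain ⟨k, a, ha, hc⟩ := exists_coefAt hf h1 0
  have h : ∀ᶠ x in 𝓝[>] (0 : I), f x ≠ x :=
    (hc.eventually_ne ha).filter_mono (nhdsGT_le_nhdsNE _)
  obtain ⟨u, hu, hsub⟩ := (mem_nhdsGT_iff_exists_Ioo_subset' (zero_lt_one (α := I))).1 h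
  obtain ⟨x, hx0, hxu⟩ := exists_between (Set.mem_Ioi.1 hu)
  obtain ⟨p, q, hg, hpx, hxq⟩ := exists_isGap hf.1 (hsub ⟨hx0, hxu⟩)
  rcases eq_or_lt_of_le (show (0 : I) ≤ p from bot_le) with rfl | hp
  · exact ⟨q, hg⟩
  · exact absurd hg.left (hsub ⟨hp, hpx.trans hxu⟩)

theorem exists_isGap_left {f : I ≃ₜ I} (hf : f ∈ analyticDiffPlus) (h1 : f ≠ 1) {q : I}
    (hq : f q = q) (hq0 : 0 < q) : ∃ p, IsGap f p q := by
  obtain ⟨k, a, ha, hc⟩ := exists_coefAt hf h1 q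
  have h : ∀ᶠ x in 𝓝[<] q, f x ≠ x :=
    (hc.eventually_ne ha).filter_mono (nhdsLT_le_nhdsNE _)
  obtain ⟨u, hu, hsub⟩ := (mem_nhdsLT_iff_exists_Ioo_subset' hq0).1 h
  obtain ⟨x, hxu, hxq⟩ := exists_between (Set.mem_Iio.1 hu)
  obtain ⟨p, r, hg, hpx, hxr⟩ := exists_isGap hf.1 (hsub ⟨hxu, hxq⟩)
  have : r = q := by
    rcases lt_trichotomy r q with h | h | h
    · exact absurd hg.right (hsub ⟨hxu.trans hxr, h⟩)
    · exact h
    · exact absurd hq (hg.ne q (hpx.trans hxq) h)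
  exact ⟨p, this ▸ hg⟩

namespace IsGap

variable {f : I ≃ₜ I} {p q : I}

theorem inv (h : IsGap f p q) : IsGap f⁻¹ p q :=
  ⟨h.lt, inv_fix h.left, inv_fix h.right, fun x hx hx' hxx => h.ne x hx hx' (by
    simpa using inv_fix hxx)⟩

theorem lt_map (h : IsGap f p q) {x₀ : I} (h1 : p < x₀) (h2 : x₀ < q) (h0 : x₀ < f x₀) {x : I}
    (hx : p < x) (hx' : x < q) : x < f x := by
  by_contra! hle
  obtain ⟨y, hy, hyy⟩ := (isPreconnected_Ioo (a := p) (b := q)).intermediate_value₂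
    (f := f) (g := fun x => x) ⟨hx, hx'⟩ ⟨h1, h2⟩ f.continuous.continuousOn
    continuousOn_id hle h0.le
  exact h.ne y hy.1 hy.2 hyy

theorem map_lt (h : IsGap f p q) {x₀ : I} (h1 : p < x₀) (h2 : x₀ < q) (h0 : f x₀ < x₀) {x : I}
    (hx : p < x) (hx' : x < q) : f x < x := by
  by_contra! hle
  obtain ⟨y, hy, hyy⟩ := (isPreconnected_Ioo (a := p) (b := q)).intermediate_value₂
    (f := f) (g := fun x => x) ⟨h1, h2⟩ ⟨hx, hx'⟩ f.continuous.continuousOn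
    continuousOn_id h0.le hle
  exact h.ne y hy.1 hy.2 hyy

/-- Up to replacing `f` by its inverse, `f` moves the points of the gap to the right. -/
theorem sign (h : IsGap f p q) (hf : StrictMono f) :
    (∀ x, p < x → x < q → x < f x) ∨ (∀ x, p < x → x < q → x < f⁻¹ x) := by
  obtain ⟨x₀, h1, h2⟩ := exists_between h.lt
  rcases lt_or_gt_of_ne (h.ne x₀ h1 h2) with h0 | h0
  · right
    intro x hx hx'
    rw [← hf.lt_iff_lt, apply_inv_self']
    exact h.map_lt h1 h2 h0 hx hx'
  · left
    intro x hx hx'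
    exact h.lt_map h1 h2 h0 hx hx'

end IsGap

theorem coe_pow_homeo (f : I ≃ₜ I) (n : ℕ) : ⇑(f ^ n) = f^[n] := by
  induction n with
  | zero => rfl
  | succ n ih => rw [pow_succ', Function.iterate_succ', ← ih]; rfl

theorem tendsto_pow_right {f : I ≃ₜ I} {p q : I} (hf : StrictMono f) (hq : f q = q)
    (h : ∀ x, p < x → x < q → x < f x) {x : I} (hx : p < x) (hx' : x < q) :
    Tendsto (fun n : ℕ => (f ^ n) x) atTop (𝓝 q) := by
  simp only [coe_pow_homeo]
  have hmono : StrictMono fun n => f^[n] x := hf.strictMono_iterate_of_lt_map (h x hx hx')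
  have hlim := tendsto_atTop_ciSup hmono.monotone ⟨1, fun _ _ => le_top⟩
  set L := ⨆ n, f^[n] x
  have hfix : f L = L := isFixedPt_of_tendsto_iterate hlim f.continuous.continuousAt
  have h1 : x ≤ L := hmono.monotone.ge_of_tendsto hlim 0
  have h2 : L ≤ q := le_of_tendsto' hlim fun n => by
    have := hf.monotone.iterate n hx'.le
    rwa [Function.iterate_fixed hq] at this
  rcases eq_or_lt_of_le h2 with h3 | h3
  · rwa [h3] at hlim
  · exact absurd hfix (h L (hx.trans_le h1) h3).ne'

theorem tendsto_pow_left {f : I ≃ₜ I} {p q : I} (hf : StrictMono f) (hp : f p = p)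
    (h : ∀ x, p < x → x < q → f x < x) {x : I} (hx : p < x) (hx' : x < q) :
    Tendsto (fun n : ℕ => (f ^ n) x) atTop (𝓝 p) := by
  simp only [coe_pow_homeo]
  have hmono : StrictAnti fun n => f^[n] x := hf.strictAnti_iterate_of_map_lt (h x hx hx')
  have hlim := tendsto_atTop_ciInf hmono.antitone ⟨0, fun _ _ => bot_le⟩
  set L := ⨅ n, f^[n] x
  have hfix : f L = L := isFixedPt_of_tendsto_iterate hlim f.continuous.continuousAt
  have h1 : L ≤ x := hmono.antitone.le_of_tendsto hlim 0
  have h2 : p ≤ L := ge_of_tendsto' hlim fun n => by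
    have := hf.monotone.iterate n hx.le
    rwa [Function.iterate_fixed hp] at this
  rcases eq_or_lt_of_le h2 with h3 | h3
  · rwa [← h3] at hlim
  · exact absurd hfix (h L h3 (h1.trans_lt hx')).ne

theorem map_inv_lt {f : I ≃ₜ I} {p q : I} (hf : StrictMono f) (hp : f p = p) (hq : f q = q)
    (h : ∀ x, p < x → x < q → x < f x) (x : I) (hx : p < x) (hx' : x < q) : f⁻¹ x < x := by
  have h1 : f p < f (f⁻¹ x) := by rwa [apply_inv_self', hp]
  have h2 : f (f⁻¹ x) < f q := by rwa [apply_inv_self', hq]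
  have h3 := h _ (hf.lt_iff_lt.1 h1) (hf.lt_iff_lt.1 h2)
  rwa [apply_inv_self'] at h3

theorem strictMono_inv {f : I ≃ₜ I} (hf : StrictMono f) : StrictMono (f⁻¹ : I ≃ₜ I) := by
  intro x y hxy
  rw [← hf.lt_iff_lt, apply_inv_self', apply_inv_self']
  exact hxy

namespace IsGap

variable {f w : I ≃ₜ I} {p q : I}

theorem exists_zpow_tendsto (h : IsGap f p q) (hf : StrictMono f) {x : I} (hx : p < x)
    (hx' : x < q) : ∃ ε : ℤ, Tendsto (fun n : ℕ => (f ^ (ε * n)) x) atTop (𝓝 p) ∧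
      Tendsto (fun n : ℕ => (f ^ (-ε * n)) x) atTop (𝓝 q) := by
  have key : ∀ g : I ≃ₜ I, IsGap g p q → StrictMono g → (∀ x, p < x → x < q → x < g x) →
      Tendsto (fun n : ℕ => (g⁻¹ ^ n) x) atTop (𝓝 p) ∧
      Tendsto (fun n : ℕ => (g ^ n) x) atTop (𝓝 q) := fun g hg hgm hs =>
    ⟨tendsto_pow_left (strictMono_inv hgm) (inv_fix hg.left)
      (map_inv_lt hgm hg.left hg.right hs) hx hx', tendsto_pow_right hgm hg.right hs hx hx'⟩
  rcases h.sign hf with hs | hs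
  · refine ⟨-1, ?_⟩
    simpa [zpow_neg] using key f h hf hs
  · refine ⟨1, ?_⟩
    simpa [zpow_neg] using key f⁻¹ h.inv (strictMono_inv hf) hs

theorem exists_zpow_left (h : IsGap f p q) (hf : StrictMono f) {x : I} (hx : p < x)
    (hx' : x < q) {U : Set I} (hU : U ∈ 𝓝 p) : ∃ m : ℤ, (f ^ m) x ∈ U := by
  obtain ⟨ε, h1, -⟩ := h.exists_zpow_tendsto hf hx hx'
  obtain ⟨n, hn⟩ := (h1.eventually hU).exists
  exact ⟨_, hn⟩

theorem exists_zpow_right (h : IsGap f p q) (hf : StrictMono f) {x : I} (hx : p < x)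
    (hx' : x < q) {U : Set I} (hU : U ∈ 𝓝 q) : ∃ m : ℤ, (f ^ m) x ∈ U := by
  obtain ⟨ε, -, h1⟩ := h.exists_zpow_tendsto hf hx hx'
  obtain ⟨n, hn⟩ := (h1.eventually hU).exists
  exact ⟨_, hn⟩

/-- Kopell's lemma for analytic maps. -/
theorem of_commute (h : IsGap f p q) (hf : f ∈ analyticDiffPlus) (hw : w ∈ analyticDiffPlus)
    (hw1 : w ≠ 1) (hc : Commute f w) : IsGap w p q := by
  have hf1 : f ≠ 1 := by
    rintro rfl
    obtain ⟨x, h1, h2⟩ := exists_between h.lt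
    exact h.ne x h1 h2 rfl
  refine ⟨h.lt, fix_of_commute hf hf1 hw.1 hc h.left, fix_of_commute hf hf1 hw.1 hc h.right,
    fun x hx hx' hwx => ?_⟩
  obtain ⟨k, a, ha, hk⟩ := exists_coefAt hw hw1 p
  have hev := hk.eventually_ne ha
  rw [eventually_nhdsWithin_iff] at hev
  -- A fixed point `x` of `w` inside the gap is carried by powers of `f` to fixed points of `w` near
  -- `p`, where `p` is the only one.
  obtain ⟨m, hm⟩ := h.exists_zpow_left hf.1 hx hx' hev
  refine hm ?_ ?_
  · intro hmp
    have h1 : (f ^ (-m)) ((f ^ m) x) = (f ^ (-m)) p := congrArg _ hmp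
    rw [← Homeomorph.mul_apply, zpow_neg, inv_mul_cancel, Homeomorph.one_apply] at h1
    have hfp : (f ^ m)⁻¹ p = p :=
      fix_of_commute hf hf1 (inv_mem (zpow_mem hf m)).1 ((Commute.refl f).zpow_right m).inv_right
        h.left
    rw [hfp] at h1
    exact hx.ne' h1
  · have h1 : w ((f ^ m) x) = (f ^ m) (w x) := DFunLike.congr_fun (hc.zpow_left m).eq.symm x
    rw [h1, hwx]

end IsGap

/-! ### Signs of leading coefficients and equality of orders -/

section Sign

variable {f : I ≃ₜ I} {p q : I} {k : ℕ} {a : ℝ}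

theorem CoefAt.nonneg_right (h : CoefAt f p k a) (hpq : p < q)
    (hs : ∀ x, p < x → x < q → x < f x) : 0 ≤ a := by
  have : NeBot (𝓝[>] p) := nhdsGT_neBot_of_exists_gt ⟨q, hpq⟩
  refine ge_of_tendsto (h.mono_left (nhdsGT_le_nhdsNE p)) ?_
  filter_upwards [Ioo_mem_nhdsGT hpq] with x hx
  exact div_nonneg (sub_nonneg.2 (hs x hx.1 hx.2).le) (pow_nonneg
    (sub_nonneg.2 (Subtype.coe_le_coe.2 hx.1.le)) _)

theorem CoefAt.tendsto_left (h : CoefAt f q k a) :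
    Tendsto (fun x : I => ((f x : ℝ) - x) / ((q : ℝ) - x) ^ k) (𝓝[<] q) (𝓝 (a * (-1) ^ k)) := by
  refine ((h.mono_left (nhdsLT_le_nhdsNE q)).mul_const ((-1) ^ k)).congr fun x => ?_
  rw [← neg_sub (q : ℝ) x, neg_eq_neg_one_mul ((q : ℝ) - x), mul_pow, div_mul_eq_mul_div,
    mul_comm ((f x : ℝ) - x), mul_div_mul_left _ _ (pow_ne_zero _ (by norm_num))]

theorem CoefAt.nonneg_left (h : CoefAt f q k a) (hpq : p < q)
    (hs : ∀ x, p < x → x < q → x < f x) : 0 ≤ a * (-1) ^ k := by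
  have : NeBot (𝓝[<] q) := nhdsLT_neBot_of_exists_lt ⟨p, hpq⟩
  refine ge_of_tendsto h.tendsto_left ?_
  filter_upwards [Ioo_mem_nhdsLT hpq] with x hx
  exact div_nonneg (sub_nonneg.2 (hs x hx.1 hx.2).le) (pow_nonneg
    (sub_nonneg.2 (Subtype.coe_le_coe.2 hx.2.le)) _)

theorem CoefAt.nonpos_left (h : CoefAt f q k a) (hpq : p < q)
    (hs : ∀ x, p < x → x < q → f x < x) : a * (-1) ^ k ≤ 0 := by
  have : NeBot (𝓝[<] q) := nhdsLT_neBot_of_exists_lt ⟨p, hpq⟩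
  refine le_of_tendsto h.tendsto_left ?_
  filter_upwards [Ioo_mem_nhdsLT hpq] with x hx
  exact div_nonpos_of_nonpos_of_nonneg (sub_nonpos.2 (hs x hx.1 hx.2).le)
    (pow_nonneg
    (sub_nonneg.2 (Subtype.coe_le_coe.2 hx.2.le)) _)

end Sign

/-- Commuting maps tangent to the identity at the left end of a gap are tangent to the same
order. -/
theorem not_coefAt_zero_of_commute {f w : I ≃ₜ I} {p q : I} {k : ℕ} {a : ℝ}
    (hf : f ∈ analyticDiffPlus) (hw : w ∈ analyticDiffPlus) (hw1 : w ≠ 1) (hc : Commute f w)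
    (hg : IsGap f p q) (hk : CoefAt f p k a) (ha : a ≠ 0) (hfm : MultAt f p 1)
    (hwm : MultAt w p 1) : ¬ CoefAt w p k 0 := by
  wlog hs : ∀ x, p < x → x < q → x < f x generalizing f a
  · have hfm' := tangent_inv hf hg.left hfm
    exact this (inv_mem hf) hc.inv_left hg.inv (hk.inv hg.left hfm') (neg_ne_zero.2 ha) hfm'
      ((hg.sign hf.1).resolve_left hs)
  intro hwk
  have hgw := hg.of_commute hf hw hw1 hc
  have hwflat : w ∈ flatSubgroup p k := ⟨hw, hgw.left, hwm, hwk⟩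
  obtain ⟨x, hx, hx'⟩ := exists_between hg.lt
  have hfx : f x < q := by
    have := hf.1 hx'
    rwa [hg.right] at this
  -- Although `w` is flatter than `f`, some power of it overtakes `f` at `x`. Then `f⁻¹ * w ^ m`
  -- moves `x`, hence the whole gap, to the right, yet its leading coefficient is `-a`.
  obtain ⟨m, hm⟩ := hgw.exists_zpow_right hw.1 hx hx' (Ioi_mem_nhds hfx)
  obtain ⟨hvA, hvp, hvm, hvk⟩ := zpow_mem hwflat m
  set v := f⁻¹ * w ^ m
  have hfm' := tangent_inv hf hg.left hfm
  have hvcoef : CoefAt v p k (-a + 0) := (hk.inv hg.left hfm').mul hvk hvp hvm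
  have hvx : x < v x := by
    rw [← hf.1.lt_iff_lt]
    change f x < f (f⁻¹ ((w ^ m) x))
    rwa [apply_inv_self']
  have hgv : IsGap v p q := by
    refine hg.of_commute hf (mul_mem (inv_mem hf) hvA) (fun h => ?_)
      ((Commute.refl f).inv_right.mul_right (hc.zpow_right m))
    rw [h] at hvx
    exact lt_irrefl _ hvx
  have h1 := hvcoef.nonneg_right hg.lt fun y hy hy' => hgv.lt_map hx hx' hvx hy hy'
  have h2 := hk.nonneg_right hg.lt hs
  exact ha (by linarith)

/-! ### Conjugation by an expanding germ -/

theorem MultAt.eventually_dist_le {g : I ≃ₜ I} {p : I} {μ M : ℝ} (h : MultAt g p μ) (hμ : 0 ≤ μ)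
    (hM : μ < M) : ∀ᶠ z : I × I in 𝓝 (p, p), dist (g z.1) (g z.2) ≤ M * dist z.1 z.2 := by
  obtain ⟨G, hG, hGg⟩ := h
  have h1 := hG.hasStrictFDerivAt.isLittleO.bound (sub_pos.2 hM)
  have h2 : Tendsto (fun z : I × I => ((z.1 : ℝ), (z.2 : ℝ))) (𝓝 (p, p)) (𝓝 ((p : ℝ), (p : ℝ))) :=
    Continuous.tendsto (by fun_prop) (p, p)
  filter_upwards [h2.eventually h1] with z hz
  simp only [hGg, ContinuousLinearMap.toSpanSingleton_apply, smul_eq_mul, Real.norm_eq_abs] at hz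
  rw [Subtype.dist_eq, Subtype.dist_eq, Real.dist_eq, Real.dist_eq]
  have h3 := abs_add_le ((g z.1 : ℝ) - g z.2 - ((z.1 : ℝ) - z.2) * μ) (((z.1 : ℝ) - z.2) * μ)
  rw [sub_add_cancel, abs_mul _ μ, abs_of_nonneg hμ] at h3
  linarith

theorem CoefAt.exists_dist_le {f : I ≃ₜ I} {p : I} {k : ℕ} {a : ℝ} (h : CoefAt f p k a)
    (hk : 2 ≤ k) (hp : f p = p) : ∃ A, ∀ᶠ y in 𝓝 p, dist (f y) y ≤ A * dist y p ^ 2 := by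
  have h5 : (fun x : I => (f x : ℝ) - x) =O[𝓝[≠] p] fun x : I => ((x : ℝ) - p) ^ k := by
    refine Asymptotics.isBigO_of_div_tendsto_nhds ?_ a h
    filter_upwards [eventually_sub_ne_zero p] with x hx hx2
    exact absurd hx2 (pow_ne_zero _ hx)
  obtain ⟨A, hA, hb⟩ := h5.exists_pos
  refine ⟨A, ?_⟩
  have h6 := hb.bound
  rw [eventually_nhdsWithin_iff] at h6
  filter_upwards [h6] with y hy
  rcases eq_or_ne y p with rfl | hyp
  · simp [hp]
  · have h7 := hy hyp
    rw [norm_pow, Real.norm_eq_abs, Real.norm_eq_abs, ← Real.dist_eq, ← Real.dist_eq,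
      ← Subtype.dist_eq, ← Subtype.dist_eq] at h7
    have h8 : dist y p ≤ 1 := by
      rw [Subtype.dist_eq, Real.dist_eq, abs_le]
      constructor <;> linarith [y.2.1, y.2.2, p.2.1, p.2.2]
    exact h7.trans (mul_le_mul_of_nonneg_left (pow_le_pow_of_le_one dist_nonneg h8 hk) hA.le)

/-- The displacement of `f` at `(g ^ n)⁻¹ x` is `O(m ^ (-2n))`, and `n` applications of `g` multiply
it by at most `M ^ n`, where `M < m ^ 2`. -/
theorem tendsto_conj_pow_of_dist_le {X : Type*} [MetricSpace X] {g f : X ≃ₜ X} {p x : X}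
    {m M A δ : ℝ} (hm : 1 < m) (hM : 1 < M) (hmM : M < m ^ 2)
    (h1 : ∀ z w, dist z p < δ → dist w p < δ → dist (g z) (g w) ≤ M * dist z w)
    (h2 : ∀ y, dist y p < δ → dist (g⁻¹ y) p ≤ m⁻¹ * dist y p)
    (h3 : ∀ y, dist y p < δ → dist (f y) y ≤ A * dist y p ^ 2) (hx : dist x p < δ / 2) :
    Tendsto (fun n : ℕ => (g ^ n * f * (g ^ n)⁻¹) x) atTop (𝓝 x) := by
  have hm0 : 0 < m := by linarith
  have hδ : 0 < δ / 2 := dist_nonneg.trans_lt hx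
  have hback : ∀ j : ℕ, dist ((g ^ j)⁻¹ x) p ≤ m⁻¹ ^ j * dist x p := by
    intro j
    induction j with
    | zero => simp
    | succ j ih =>
      have h4 : dist ((g ^ j)⁻¹ x) p < δ := by
        have : m⁻¹ ^ j ≤ 1 := pow_le_one₀ (by positivity) (inv_le_one_of_one_le₀ hm.le)
        nlinarith [dist_nonneg (x := x) (y := p)]
      rw [pow_succ, mul_inv_rev, Homeomorph.mul_apply, pow_succ', mul_assoc]
      exact (h2 _ h4).trans (by gcongr)
  have hback' : ∀ j : ℕ, dist ((g ^ j)⁻¹ x) p ≤ dist x p := fun j => by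
    have : m⁻¹ ^ j ≤ 1 := pow_le_one₀ (by positivity) (inv_le_one_of_one_le₀ hm.le)
    nlinarith [hback j, dist_nonneg (x := x) (y := p)]
  set B := |A| * dist x p ^ 2
  have hd0 : ∀ n : ℕ, M ^ n * dist (f ((g ^ n)⁻¹ x)) ((g ^ n)⁻¹ x) ≤ B * (M / m ^ 2) ^ n := by
    intro n
    have h4 := h3 ((g ^ n)⁻¹ x) (by linarith [hback' n])
    have h5 : A * dist ((g ^ n)⁻¹ x) p ^ 2 ≤ |A| * (m⁻¹ ^ n * dist x p) ^ 2 := by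
      gcongr
      · exact le_abs_self A
      · exact hback n
    calc M ^ n * dist (f ((g ^ n)⁻¹ x)) ((g ^ n)⁻¹ x)
        ≤ M ^ n * (|A| * (m⁻¹ ^ n * dist x p) ^ 2) := by
          gcongr
          exact h4.trans h5
      _ = B * (M / m ^ 2) ^ n := by
          simp only [B, div_pow, inv_pow, mul_pow]
          field_simp
          ring
  have hlim : Tendsto (fun n : ℕ => B * (M / m ^ 2) ^ n) atTop (𝓝 0) := by
    have := tendsto_pow_atTop_nhds_zero_of_lt_one (r := M / m ^ 2) (by positivity)
      ((div_lt_one (by positivity)).2 hmM)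
    simpa using this.const_mul B
  rw [tendsto_iff_dist_tendsto_zero]
  refine squeeze_zero' (Eventually.of_forall fun _ => dist_nonneg) ?_ hlim
  filter_upwards [hlim.eventually (gt_mem_nhds hδ)] with n hn
  refine le_trans ?_ (hd0 n)
  set y := (g ^ n)⁻¹ x with hy
  -- The Lipschitz bound holds only in the `δ`-ball. The reference orbit stays within `δ / 2`, and
  -- the bound already obtained for `n` keeps the perturbed orbit within `δ / 2` of it.
  have key : ∀ j ≤ n, dist ((g ^ j) (f y)) ((g ^ j) y) ≤ M ^ j * dist (f y) y := by
    intro j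
    induction j with
    | zero => simp
    | succ j ih =>
      intro hj
      have hj' : j ≤ n := by omega
      have h4 : (g ^ j) y = (g ^ (n - j))⁻¹ x := by
        rw [hy, ← Homeomorph.mul_apply]
        congr 1
        rw [← Nat.sub_add_cancel hj', pow_add, mul_inv_rev, mul_inv_cancel_left,
          Nat.add_sub_cancel]
      have h5 : dist ((g ^ j) y) p ≤ dist x p := h4 ▸ hback' (n - j)
      have h6 : dist ((g ^ j) (f y)) p < δ := by
        have h7 := dist_triangle ((g ^ j) (f y)) ((g ^ j) y) p
        have h8 : M ^ j * dist (f y) y ≤ M ^ n * dist (f y) y := by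
          gcongr
          exact hM.le
        have := ih hj'
        linarith [hd0 n]
      rw [pow_succ', Homeomorph.mul_apply, Homeomorph.mul_apply, pow_succ', mul_assoc]
      refine (h1 _ _ h6 (by linarith)).trans ?_
      gcongr
      exact ih hj'
  have := key n le_rfl
  have hyx : (g ^ n) y = x := by
    rw [hy, ← Homeomorph.mul_apply, mul_inv_cancel, Homeomorph.one_apply]
  rw [hyx] at this
  exact this

/-- Conjugating a map tangent to the identity at `p` by an expansion at `p` makes it converge to
the identity near `p`. -/
theorem eventually_tendsto_conj_pow {g f : I ≃ₜ I} {p : I} {μ a : ℝ} {k : ℕ} (hμ : 1 < μ)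
    (hg : g p = p) (hgm : MultAt g p μ) (hgm' : MultAt g⁻¹ p μ⁻¹) (hf : CoefAt f p k a)
    (hk : 2 ≤ k) (hp : f p = p) :
    ∀ᶠ x in 𝓝 p, Tendsto (fun n : ℕ => (g ^ n * f * (g ^ n)⁻¹) x) atTop (𝓝 x) := by
  -- The constants satisfy `1 < m < μ < M < m ^ 2`.
  obtain ⟨M, hM, hM'⟩ := exists_between (show μ < μ ^ 2 by nlinarith)
  have hμ0 : 0 < μ := by linarith
  obtain ⟨m, hm, hm'⟩ := exists_between ((Real.sqrt_lt' hμ0).2 hM')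
  have hmM : M < m ^ 2 := Real.lt_sq_of_sqrt_lt hm
  have hm1 : 1 < m := ((Real.lt_sqrt zero_le_one).2 (by linarith)).trans hm
  have e1 := hgm.eventually_dist_le hμ0.le hM
  have e2 := hgm'.eventually_dist_le (inv_pos.2 hμ0).le (inv_strictAnti₀ (by linarith) hm')
  obtain ⟨A, e3⟩ := hf.exists_dist_le hk hp
  rw [Metric.eventually_nhds_iff] at e1 e2 e3
  obtain ⟨δ₁, hδ₁, e1⟩ := e1
  obtain ⟨δ₂, hδ₂, e2⟩ := e2
  obtain ⟨δ₃, hδ₃, e3⟩ := e3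
  set δ := min δ₁ (min δ₂ δ₃)
  have hδ : 0 < δ := lt_min hδ₁ (lt_min hδ₂ hδ₃)
  have d1 : δ ≤ δ₁ := min_le_left _ _
  have d2 : δ ≤ δ₂ := (min_le_right _ _).trans (min_le_left _ _)
  have d3 : δ ≤ δ₃ := (min_le_right _ _).trans (min_le_right _ _)
  filter_upwards [Metric.ball_mem_nhds p (half_pos hδ)] with x hx
  refine tendsto_conj_pow_of_dist_le hm1 (by linarith) hmM (δ := δ) (A := A) (fun z w hz hw => ?_)
    (fun y hy => ?_) (fun y hy => e3 (hy.trans_le d3)) hx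
  · refine e1 (y := (z, w)) ?_
    rw [Prod.dist_eq]
    exact max_lt (hz.trans_le d1) (hw.trans_le d1)
  · have := e2 (y := (y, p)) (by
      rw [Prod.dist_eq]
      exact max_lt (hy.trans_le d2) (by simpa using hδ₂))
    rwa [inv_fix hg] at this

/-! ### From pointwise to uniform convergence -/

/-- Monotone maps of `I` converging pointwise to the identity converge uniformly. -/
theorem eventually_c0Dist_lt {h : ℕ → I ≃ₜ I} (hm : ∀ n, StrictMono (h n))
    (hlim : ∀ x, Tendsto (fun n => h n x) atTop (𝓝 x)) {ε : ℝ} (hε : 0 < ε) :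
    ∀ᶠ n in atTop, c0Dist 1 (h n) < ε := by
  -- On a grid of mesh below `ε / 4`, monotonicity traps `h n x` between the images of neighbouring
  -- nodes, so the mesh and the error at a node add up to at most `ε / 2`.
  obtain ⟨N, hN⟩ := exists_nat_one_div_lt (show 0 < ε / 4 by linarith)
  have hN0 : (0 : ℝ) < (N : ℝ) + 1 := by positivity
  have hgrid : ∀ i : Fin (N + 2), (i : ℝ) / ((N : ℝ) + 1) ∈ Set.Icc (0 : ℝ) 1 := fun i => by
    have : (i : ℝ) ≤ (N : ℝ) + 1 := by exact_mod_cast Nat.lt_succ_iff.1 i.2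
    exact ⟨by positivity, (div_le_one hN0).2 this⟩
  have hev : ∀ᶠ n in atTop, ∀ i : Fin (N + 2),
      dist (h n ⟨_, hgrid i⟩) ⟨_, hgrid i⟩ < ε / 4 :=
    eventually_all.2 fun i =>
      (tendsto_iff_dist_tendsto_zero.1 (hlim ⟨_, hgrid i⟩)).eventually (gt_mem_nhds (by linarith))
  filter_upwards [hev] with n hn
  refine lt_of_le_of_lt ((ContinuousMap.dist_le (C := ε / 2) (by linarith)).2 fun x => ?_)
    (by linarith : ε / 2 < ε)
  change dist x (h n x) ≤ ε / 2
  rw [Subtype.dist_eq, Real.dist_eq, abs_le]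
  set j := ⌊(x : ℝ) * ((N : ℝ) + 1)⌋₊ with hj
  have hx0 : 0 ≤ (x : ℝ) * ((N : ℝ) + 1) := mul_nonneg x.2.1 hN0.le
  have hj1 : (j : ℝ) ≤ x * ((N : ℝ) + 1) := Nat.floor_le hx0
  have hj2 : (x : ℝ) * ((N : ℝ) + 1) < j + 1 := Nat.lt_floor_add_one _
  have hjN : j ≤ N + 1 := by
    have : (j : ℝ) ≤ ((N + 1 : ℕ) : ℝ) := by
      push_cast
      nlinarith [x.2.2]
    exact_mod_cast this
  have hlo : (j : ℝ) / ((N : ℝ) + 1) ≤ x := (div_le_iff₀ hN0).2 hj1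
  have hhi : (x : ℝ) < (j : ℝ) / ((N : ℝ) + 1) + 1 / ((N : ℝ) + 1) := by
    rw [← add_div]
    exact (lt_div_iff₀ hN0).2 hj2
  have h1 := hn ⟨j, by omega⟩
  rw [Subtype.dist_eq, Real.dist_eq, abs_lt] at h1
  have h1' : (h n ⟨_, hgrid ⟨j, by omega⟩⟩ : ℝ) ≤ h n x :=
    (hm n).monotone (show (⟨_, hgrid ⟨j, by omega⟩⟩ : I) ≤ x from hlo)
  simp only at h1 h1'
  refine ⟨?_, by linarith⟩
  rcases Nat.lt_or_ge j (N + 1) with hlt | hge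
  · have h2 := hn ⟨j + 1, by omega⟩
    rw [Subtype.dist_eq, Real.dist_eq, abs_lt] at h2
    have h3 : (x : ℝ) ≤ ((j + 1 : ℕ) : ℝ) / ((N : ℝ) + 1) := by
      push_cast
      rw [add_div]
      exact hhi.le
    have h2' : (h n x : ℝ) ≤ h n ⟨_, hgrid ⟨j + 1, by omega⟩⟩ :=
      (hm n).monotone (show x ≤ (⟨_, hgrid ⟨j + 1, by omega⟩⟩ : I) from h3)
    simp only at h2 h2'
    have h4 : ((j + 1 : ℕ) : ℝ) / ((N : ℝ) + 1) = (j : ℝ) / ((N : ℝ) + 1) + 1 / ((N : ℝ) + 1) := by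
      push_cast
      rw [add_div]
    linarith [h2.2]
  · have h3 : (j : ℝ) / ((N : ℝ) + 1) = 1 := by
      rw [le_antisymm hjN hge]
      push_cast
      exact div_self hN0.ne'
    have := (h n x).2.2
    linarith

/-! ### Centralizers are abelian -/

theorem CoefAt.of_lt {f : I ≃ₜ I} {p : I} {j k : ℕ} {a : ℝ} (h : CoefAt f p k a) (hj : j < k) :
    CoefAt f p j 0 := by
  have h2 := Tendsto.mul h (tendsto_pow_sub p (show 1 ≤ k - j by omega))
  rw [mul_zero] at h2
  refine h2.congr' ?_
  filter_upwards [eventually_sub_ne_zero p] with x hx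
  obtain ⟨i, rfl⟩ : ∃ i, k = j + i := ⟨k - j, by omega⟩
  rw [Nat.add_sub_cancel_left, pow_add]
  field_simp

/-- The centralizer of a nontrivial analytic diffeomorphism of `I` is abelian. -/
theorem commute_of_commute {f g₁ g₂ : I ≃ₜ I} (hf : f ∈ analyticDiffPlus) (hf1 : f ≠ 1)
    (hg₁ : g₁ ∈ analyticDiffPlus) (hg₂ : g₂ ∈ analyticDiffPlus) (hc₁ : Commute f g₁)
    (hc₂ : Commute f g₂) : Commute g₁ g₂ := by
  by_contra hnc
  have hne : g₁ * g₂ * g₁⁻¹ * g₂⁻¹ ≠ 1 := fun h => hnc (commutatorElement_eq_one_iff_commute.1 h)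
  have fix : ∀ g ∈ analyticDiffPlus, g 0 = 0 := fun g hg => fix_zero hg.1
  obtain ⟨μ, hμ, hfm, -⟩ := exists_multAt hf (fix f hf)
  obtain ⟨μ₁, hμ₁, hm₁, hm₁'⟩ := exists_multAt hg₁ (fix g₁ hg₁)
  obtain ⟨μ₂, hμ₂, hm₂, hm₂'⟩ := exists_multAt hg₂ (fix g₂ hg₂)
  have hi₁ := inv_mem hg₁
  have hi₂ := inv_mem hg₂
  have hcA : (g₁ * g₂ * g₁⁻¹ * g₂⁻¹) ∈ analyticDiffPlus := mul_mem (mul_mem (mul_mem hg₁ hg₂) hi₁) hi₂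
  have hcm : MultAt (g₁ * g₂ * g₁⁻¹ * g₂⁻¹) 0 1 := by
    have := ((hm₁.mul hm₂ (fix _ hg₂)).mul hm₁' (fix _ hi₁)).mul hm₂' (fix _ hi₂)
    rwa [show μ₁ * μ₂ * μ₁⁻¹ * μ₂⁻¹ = 1 by field_simp] at this
  have hcc : Commute f (g₁ * g₂ * g₁⁻¹ * g₂⁻¹) :=
    ((hc₁.mul_right hc₂).mul_right hc₁.inv_right).mul_right hc₂.inv_right
  rcases ne_or_eq μ 1 with hμ1 | rfl
  · exact hne (eq_one_of_commute_hyperbolic hμ hμ1 hcA (fix f hf) (fix _ hcA) hcc hfm hcm)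
  obtain ⟨q, hgap⟩ := exists_isGap_zero hf hf1
  obtain ⟨k, a, ha, hk⟩ := exists_coefAt hf hf1 0
  have hk2 := hk.two_le ha (fix f hf) hfm
  -- A hyperbolic `g` commuting with `f` would force `f = 1`.
  have tang : ∀ g ∈ analyticDiffPlus, Commute f g → MultAt g 0 1 := by
    intro g hg hc
    obtain ⟨ν, hν, hm, -⟩ := exists_multAt hg (fix g hg)
    rcases eq_or_ne ν 1 with rfl | hν1
    · exact hm
    · exact absurd (eq_one_of_commute_hyperbolic hν hν1 hf (fix g hg) (fix f hf) hc.symm hm hfm) hf1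
  have coef : ∀ g ∈ analyticDiffPlus, Commute f g → ∃ b, CoefAt g 0 k b := by
    intro g hg hc
    rcases eq_or_ne g 1 with rfl | hg1
    · exact ⟨0, CoefAt.one 0 k⟩
    obtain ⟨j, b, hb, hj⟩ := exists_coefAt hg hg1 0
    have hgm := tang g hg hc
    rcases lt_trichotomy j k with h | h | h
    · exact absurd (hk.of_lt h) (not_coefAt_zero_of_commute hg hf hf1 hc.symm
        (hgap.of_commute hf hg hg1 hc) hj hb hgm hfm)
    · exact ⟨b, h ▸ hj⟩
    · exact ⟨0, hj.of_lt h⟩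
  obtain ⟨b₁, hb₁⟩ := coef g₁ hg₁ hc₁
  obtain ⟨b₂, hb₂⟩ := coef g₂ hg₂ hc₂
  have ht₁ := tang _ hi₁ hc₁.inv_right
  have ht₂ := tang _ hi₂ hc₂.inv_right
  -- At the common order `k` coefficients add under composition, so the commutator is flatter than
  -- `f`, which it commutes with.
  have h1 := ((hb₁.mul hb₂ (fix _ hg₂) (tang _ hg₂ hc₂)).mul (hb₁.inv (fix _ hg₁) ht₁)
    (fix _ hi₁) ht₁).mul (hb₂.inv (fix _ hg₂) ht₂) (fix _ hi₂) ht₂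
  rw [show b₁ + b₂ + -b₁ + -b₂ = 0 by ring] at h1
  exact not_coefAt_zero_of_commute hf hcA hne hcc hgap hk ha hfm hcm h1

/-! ### Spreading convergence across the gaps -/

theorem tendsto_of_commute_zpow {h : ℕ → I ≃ₜ I} {f : I ≃ₜ I} {m : ℤ} {x : I}
    (hc : ∀ n, Commute f (h n)) (hx : Tendsto (fun n => h n ((f ^ m) x)) atTop (𝓝 ((f ^ m) x))) :
    Tendsto (fun n => h n x) atTop (𝓝 x) := by
  have hback : ∀ y, ((f ^ m)⁻¹) ((f ^ m) y) = y := fun y => inv_apply_self' _ y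
  have h2 := ((f ^ m)⁻¹.continuous.tendsto _).comp hx
  rw [hback] at h2
  refine h2.congr fun n => ?_
  have h3 : h n ((f ^ m) x) = (f ^ m) (h n x) :=
    DFunLike.congr_fun ((hc n).zpow_left m).eq.symm x
  rw [Function.comp_apply, h3, hback]

section Normalizer

variable {N : Subgroup (I ≃ₜ I)} {f g : I ≃ₜ I}

theorem conj_pow_mem (hn : ∀ u ∈ N, g * u * g⁻¹ ∈ N) {u : I ≃ₜ I} (hu : u ∈ N) (n : ℕ) :
    g ^ n * u * (g ^ n)⁻¹ ∈ N := by
  induction n with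
  | zero => simpa using hu
  | succ n ih =>
    have := hn _ ih
    rw [pow_succ', mul_inv_rev]
    simpa only [mul_assoc] using this

theorem CoefAt.conj_pow {p : I} {k : ℕ} {a μ : ℝ} {u : I ≃ₜ I} (hu : CoefAt u p k a)
    (hup : u p = p) (hgp : g p = p) (hm : MultAt g p μ) (hμ : 0 < μ) (n : ℕ) :
    CoefAt (g ^ n * u * (g ^ n)⁻¹) p k (a * (μ / μ ^ k) ^ n) := by
  induction n with
  | zero => simpa using hu
  | succ n ih =>
    have hgn : (g ^ n) p = p := by
      rw [coe_pow_homeo]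
      exact Function.iterate_fixed hgp n
    have := ih.conj (mul_fix (mul_fix hgn hup) (inv_fix hgn)) hgp hm hμ
    rw [pow_succ', mul_inv_rev, pow_succ]
    convert this using 1
    · simp only [mul_assoc]
    · ring

variable (hNA : N ≤ analyticDiffPlus) (hcomm : ∀ u ∈ N, ∀ v ∈ N, Commute u v)
  (hgA : g ∈ analyticDiffPlus) (hn : ∀ u ∈ N, g * u * g⁻¹ ∈ N) (hf : f ∈ N) (hf1 : f ≠ 1)
  (htan : ∀ u ∈ N, ∀ p, f p = p → MultAt u p 1) (hfix : ∀ p, f p = p → g p = p)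

include hNA hcomm hgA hn hf hf1 htan hfix

theorem tendsto_conj_pow_of_gap {p q : I} (hgap : IsGap f p q) {μ : ℝ} (hμ : 1 < μ)
    (hm : MultAt g p μ) {u : I ≃ₜ I} (hu : u ∈ N) (hu1 : u ≠ 1) {x : I} (hx : p < x)
    (hx' : x < q) : Tendsto (fun n : ℕ => (g ^ n * u * (g ^ n)⁻¹) x) atTop (𝓝 x) := by
  have hgp := hfix p hgap.left
  have hup : u p = p :=
    fix_of_commute (hNA hf) hf1 (hNA hu).1 (hcomm f hf u hu) hgap.left
  obtain ⟨ν, hν, hν1, hν2⟩ := exists_multAt hgA hgp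
  obtain rfl := hν1.unique hm hgp
  obtain ⟨k, a, ha, hk⟩ := exists_coefAt (hNA hu) hu1 p
  have hev := eventually_tendsto_conj_pow hμ hgp hν1 hν2 hk
    (hk.two_le ha hup (htan u hu p hgap.left)) hup
  obtain ⟨m, hm⟩ := hgap.exists_zpow_left (hNA hf).1 hx hx' hev
  exact tendsto_of_commute_zpow (fun n => hcomm f hf _ (conj_pow_mem hn hu n)) hm

/-- If `ν ≤ 1`, conjugation by `g ^ n` would not decrease the leading coefficient of `u` at `q` in
absolute value. But inside the gap the conjugates tend to the identity, and comparing `u` with the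
square of one of them contradicts this. -/
theorem one_lt_multAt_of_gap {p q : I} (hgap : IsGap f p q) {μ : ℝ} (hμ : 1 < μ)
    (hm : MultAt g p μ) : ∃ ν, 1 < ν ∧ MultAt g q ν := by
  have hgq := hfix q hgap.right
  obtain ⟨ν, hν, hνm, -⟩ := exists_multAt hgA hgq
  refine ⟨ν, ?_, hνm⟩
  obtain ⟨u, hu, hu1, hug, hs⟩ : ∃ u ∈ N, u ≠ 1 ∧ IsGap u p q ∧
      ∀ x, p < x → x < q → x < u x := by
    rcases hgap.sign (hNA hf).1 with hs | hs
    · exact ⟨f, hf, hf1, hgap, hs⟩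
    · exact ⟨f⁻¹, inv_mem hf, inv_ne_one.2 hf1, hgap.inv, hs⟩
  have huA := hNA hu
  have hum := htan u hu q hgap.right
  have hum' := htan _ (inv_mem hu) q hgap.right
  obtain ⟨k, a, ha, hk⟩ := exists_coefAt huA hu1 q
  have hk2 := hk.two_le ha hug.right hum
  obtain ⟨x, hx, hx'⟩ := exists_between hgap.lt
  have huxq : u x < q := by
    have := huA.1 hx'
    rwa [hug.right] at this
  obtain ⟨y, hxy, hyu⟩ := exists_between (hs x hx hx')
  have hconv := fun z hz hz' => tendsto_conj_pow_of_gap hNA hcomm hgA hn hf hf1 htan hfix hgap hμ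
    hm hu hu1 (x := z) hz hz'
  obtain ⟨n, hn1, hn2⟩ := (((hconv x hx hx').eventually (gt_mem_nhds hxy)).and
    ((hconv y (hx.trans hxy) (hyu.trans huxq)).eventually (gt_mem_nhds hyu))).exists
  have hhN : g ^ n * u * (g ^ n)⁻¹ ∈ N := conj_pow_mem hn hu n
  have hhk : CoefAt (g ^ n * u * (g ^ n)⁻¹) q k (a * (ν / ν ^ k) ^ n) :=
    hk.conj_pow hug.right hgq hνm hν n
  set h := g ^ n * u * (g ^ n)⁻¹
  have hhq : h q = q :=
    fix_of_commute (hNA hf) hf1 (hNA hhN).1 (hcomm f hf h hhN) hgap.right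
  have hhm := htan h hhN q hgap.right
  -- The square yields the factor `2` in `e4`, which excludes `ν = 1`; a single `h` would only give
  -- `1 ≤ ν`.
  have hvN : u⁻¹ * (h * h) ∈ N := mul_mem (inv_mem hu) (mul_mem hhN hhN)
  have hvk := (hk.inv hug.right hum').mul (hhk.mul hhk hhq hhm) (mul_fix hhq hhq)
    (htan _ (mul_mem hhN hhN) q hgap.right)
  set v := u⁻¹ * (h * h)
  have hvx : v x < x := by
    rw [← huA.1.lt_iff_lt]
    change u (u⁻¹ (h (h x))) < u x
    rw [apply_inv_self']
    exact ((hNA hhN).1 hn1).trans hn2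
  have hvgap : IsGap v p q := by
    refine hgap.of_commute (hNA hf) (hNA hvN) (fun h1 => ?_) (hcomm f hf v hvN)
    rw [h1] at hvx
    exact lt_irrefl _ hvx
  have e1 := hvk.nonpos_left hgap.lt fun z hz hz' => hvgap.map_lt hx hx' hvx hz hz'
  have e2 := hk.nonneg_left hgap.lt hs
  have e3 : 0 < a * (-1) ^ k :=
    lt_of_le_of_ne e2 (mul_ne_zero ha (pow_ne_zero _ (by norm_num))).symm
  have e4 : 2 * (ν / ν ^ k) ^ n ≤ 1 := by
    by_contra! hlt
    nlinarith
  by_contra! hν1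
  have e5 : 1 ≤ ν / ν ^ k := by
    rw [le_div_iff₀ (by positivity), one_mul]
    exact (pow_le_pow_of_le_one hν.le hν1 (show 1 ≤ k by omega)).trans (pow_one ν).le
  have := one_le_pow₀ e5 (n := n)
  linarith

/-- At the least exceptional fixed point, the gap to its left would start at a point where the
multiplier exceeds `1`, and `one_lt_multAt_of_gap` applies. -/
theorem one_lt_multAt_of_fix {μ : ℝ} (hμ : 1 < μ) (hm : MultAt g 0 μ) {q : I} (hq : f q = q) :
    ∃ ν, 1 < ν ∧ MultAt g q ν := by
  by_contra hbad
  obtain ⟨r, ⟨hr, hrbad⟩, hrmin⟩ := Set.exists_min_image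
    {q | f q = q ∧ ¬ ∃ ν, 1 < ν ∧ MultAt g q ν} id
    ((finite_fix (hNA hf) hf1).subset fun _ h => h.1) ⟨q, hq, hbad⟩
  have hr0 : 0 < r := by
    rcases eq_or_lt_of_le (unitInterval.nonneg' (t := r)) with h | h
    · exact absurd ⟨μ, hμ, h ▸ hm⟩ hrbad
    · exact h
  obtain ⟨p, hgap⟩ := exists_isGap_left (hNA hf) hf1 hr hr0
  by_cases hp : ∃ ν, 1 < ν ∧ MultAt g p ν
  · obtain ⟨ν, hν, hνm⟩ := hp
    exact hrbad (one_lt_multAt_of_gap hNA hcomm hgA hn hf hf1 htan hfix hgap hν hνm)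
  · exact hgap.lt.not_ge (hrmin p ⟨hgap.left, hp⟩)

theorem tendsto_conj_pow_of_one_lt {μ : ℝ} (hμ : 1 < μ) (hm : MultAt g 0 μ) (x : I) :
    Tendsto (fun n : ℕ => (g ^ n * f * (g ^ n)⁻¹) x) atTop (𝓝 x) := by
  by_cases hx : f x = x
  · refine tendsto_const_nhds.congr fun n => ?_
    have hgn : (g ^ n) x = x := by
      rw [coe_pow_homeo]
      exact Function.iterate_fixed (hfix x hx) n
    exact (mul_fix (mul_fix hgn hx) (inv_fix hgn)).symm
  · obtain ⟨p, q, hgap, hpx, hxq⟩ := exists_isGap (hNA hf).1 hx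
    obtain ⟨ν, hν, hνm⟩ := one_lt_multAt_of_fix hNA hcomm hgA hn hf hf1 htan hfix hμ hm hgap.left
    exact tendsto_conj_pow_of_gap hNA hcomm hgA hn hf hf1 htan hfix hgap hν hνm hf hf1 hpx hxq

end Normalizer

/-! ### Non-discreteness -/

theorem not_isC0Discrete_of_not_commute {N : Subgroup (I ≃ₜ I)} {f g : I ≃ₜ I}
    (hNA : N ≤ analyticDiffPlus) (hcomm : ∀ u ∈ N, ∀ v ∈ N, Commute u v)
    (hgA : g ∈ analyticDiffPlus) (hn : ∀ u ∈ N, g * u * g⁻¹ ∈ N)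
    (hn' : ∀ u ∈ N, g⁻¹ * u * g ∈ N) (hf : f ∈ N) (hfg : ¬ Commute g f) :
    ¬ IsC0Discrete N := by
  have hf1 : f ≠ 1 := by
    rintro rfl
    exact hfg (Commute.one_right g)
  have hfA := hNA hf
  have hfix : ∀ p, f p = p → g p = p := by
    refine fun p hp => fix_of_mapsTo (finite_fix hfA hf1) hgA.1 (fun x hx => ?_) hp
    -- The conjugate `g⁻¹ * f * g` commutes with `f`, so it fixes `x`; hence `f` fixes `g x`.
    have h1 := fix_of_commute hfA hf1 (hNA (hn' f hf)).1 (hcomm f hf _ (hn' f hf)) hx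
    have h2 : g ((g⁻¹ * f * g) x) = f (g x) := apply_inv_self' g (f (g x))
    rw [h1] at h2
    exact h2.symm
  have hw1 : g * f * g⁻¹ * f⁻¹ ≠ 1 := fun h => hfg (commutatorElement_eq_one_iff_commute.1 h)
  have hwN : g * f * g⁻¹ * f⁻¹ ∈ N := mul_mem (hn f hf) (inv_mem hf)
  have htan : ∀ u ∈ N, ∀ p, f p = p → MultAt u p 1 := by
    intro u hu p hp
    have hup := fix_of_commute hfA hf1 (hNA hu).1 (hcomm f hf u hu) hp
    have hgp := hfix p hp
    obtain ⟨μ, hμ, hm, -⟩ := exists_multAt (hNA hu) hup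
    obtain ⟨μ₁, hμ₁, hm₁, hm₁'⟩ := exists_multAt hgA hgp
    obtain ⟨μ₂, hμ₂, hm₂, hm₂'⟩ := exists_multAt hfA hp
    -- The commutator of `g` and `f` is tangent to the identity, so a hyperbolic `u` commuting with
    -- it would make it trivial.
    have hwm := ((hm₁.mul hm₂ hp).mul hm₁' (inv_fix hgp)).mul hm₂' (inv_fix hp)
    rw [show μ₁ * μ₂ * μ₁⁻¹ * μ₂⁻¹ = 1 by field_simp] at hwm
    rcases eq_or_ne μ 1 with rfl | hμ1
    · exact hm
    · exact absurd (eq_one_of_commute_hyperbolic hμ hμ1 (hNA hwN) hup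
        (mul_fix (mul_fix (mul_fix hgp hp) (inv_fix hgp)) (inv_fix hp)) (hcomm u hu _ hwN) hm hwm)
        hw1
  have hf0 := fix_zero hfA.1
  obtain ⟨μ, hμ, hm, hm'⟩ := exists_multAt hgA (hfix 0 hf0)
  have hμ1 : μ ≠ 1 := by
    rintro rfl
    obtain ⟨k, a, ha, hk⟩ := exists_coefAt hfA hf1 0
    obtain ⟨q, hgap⟩ := exists_isGap_zero hfA hf1
    have hi := htan _ (inv_mem hf) 0 hf0
    -- With `μ = 1` conjugation preserves the coefficient `a`, so the commutator has coefficient `a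
    -- - a = 0`: it is flatter than `f`.
    have h1 := (hk.conj hf0 (hfix 0 hf0) hm hμ).mul (hk.inv hf0 hi) (inv_fix hf0) hi
    rw [one_pow, div_one, mul_one, add_neg_cancel] at h1
    exact not_coefAt_zero_of_commute hfA (hNA hwN) hw1 (hcomm f hf _ hwN) hgap hk ha
      (htan f hf 0 hf0) (htan _ hwN 0 hf0) h1
  obtain ⟨h, hhN, hh1, hlim⟩ : ∃ h : ℕ → I ≃ₜ I, (∀ n, h n ∈ N) ∧ (∀ n, h n ≠ 1) ∧
      ∀ x, Tendsto (fun n => h n x) atTop (𝓝 x) := by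
    have hne : ∀ b : I ≃ₜ I, b * f * b⁻¹ ≠ 1 := fun b h => hf1 (conj_eq_one_iff.1 h)
    rcases lt_or_gt_of_ne hμ1 with hlt | hgt
    · have hni : ∀ u ∈ N, g⁻¹ * u * g⁻¹⁻¹ ∈ N := by simpa using hn'
      exact ⟨fun n => g⁻¹ ^ n * f * (g⁻¹ ^ n)⁻¹, fun n => conj_pow_mem hni hf n,
        fun n => hne _, tendsto_conj_pow_of_one_lt hNA hcomm (inv_mem hgA) hni hf hf1 htan
          (fun p hp => inv_fix (hfix p hp)) ((one_lt_inv₀ hμ).2 hlt) hm'⟩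
    · exact ⟨fun n => g ^ n * f * (g ^ n)⁻¹, fun n => conj_pow_mem hn hf n,
        fun n => hne _, tendsto_conj_pow_of_one_lt hNA hcomm hgA hn hf hf1 htan hfix hgt hm⟩
  intro hdisc
  obtain ⟨ε, hε, hiso⟩ := hdisc 1 (one_mem N)
  obtain ⟨n, hn⟩ := (eventually_c0Dist_lt (fun n => (hNA (hhN n)).1) hlim hε).exists
  exact hh1 n (hiso _ (hhN n) hn)

theorem not_isC0Discrete_of_normal {Γ N : Subgroup (I ≃ₜ I)} (hΓ : Γ ≤ analyticDiffPlus)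
    (hnonab : ¬ IsMulCommutative Γ) (hNΓ : N ≤ Γ) (hnorm : (N.subgroupOf Γ).Normal)
    (hN : IsMulCommutative N) (hne : N ≠ ⊥) : ¬ IsC0Discrete N := by
  have hcomm : ∀ u ∈ N, ∀ v ∈ N, Commute u v := fun u hu v hv =>
    congrArg Subtype.val (hN.is_comm.comm ⟨u, hu⟩ ⟨v, hv⟩)
  have hconj : ∀ g ∈ Γ, ∀ u ∈ N, g * u * g⁻¹ ∈ N := fun g hg u hu =>
    hnorm.conj_mem ⟨u, hNΓ hu⟩ hu ⟨g, hg⟩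
  obtain ⟨f₀, hf₀, hf₀1⟩ := (Subgroup.bot_or_exists_ne_one N).resolve_left hne
  by_cases hex : ∃ g ∈ Γ, ¬ Commute g f₀
  · obtain ⟨g, hg, hgf⟩ := hex
    exact not_isC0Discrete_of_not_commute (hNΓ.trans hΓ) hcomm (hΓ hg) (hconj g hg)
      (fun u hu => by simpa using hconj g⁻¹ (inv_mem hg) u hu) hf₀ hgf
  · push Not at hex
    refine absurd ⟨⟨fun a b => Subtype.ext ?_⟩⟩ hnonab
    exact commute_of_commute (hΓ (hNΓ hf₀)) hf₀1 (hΓ a.2) (hΓ b.2) (hex a a.2).symm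
      (hex b b.2).symm

theorem IsC0Discrete.mono {G H : Subgroup (I ≃ₜ I)} (h : G ≤ H) (hH : IsC0Discrete H) :
    IsC0Discrete G := fun f hf => by
  obtain ⟨ε, hε, hiso⟩ := hH f (h hf)
  exact ⟨ε, hε, fun g hg => hiso g (h hg)⟩

/-- A nontrivial solvable group has a nontrivial abelian normal subgroup. -/
theorem exists_normal_isMulCommutative_of_isSolvable {G : Type*} [Group G] [Group.IsSolvable G]
    [Nontrivial G] : ∃ K : Subgroup G, K.Normal ∧ IsMulCommutative K ∧ K ≠ ⊥ := by
  classical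
  have hex : ∃ n, derivedSeries G n = ⊥ := Group.IsSolvable.solvable
  have hpos : Nat.find hex ≠ 0 := fun h => by
    have := Nat.find_spec hex
    rw [h, derivedSeries_zero] at this
    exact bot_ne_top this.symm
  -- The last nontrivial term of the derived series is abelian.
  obtain ⟨m, hm⟩ := Nat.exists_eq_succ_of_ne_zero hpos
  refine ⟨derivedSeries G m, derivedSeries_normal G m, ⟨⟨fun a b => Subtype.ext ?_⟩⟩,
    Nat.find_min hex (by omega)⟩
  have h1 := Nat.find_spec hex
  rw [hm, derivedSeries_succ] at h1
  have h2 := Subgroup.commutator_mem_commutator a.2 b.2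
  rw [h1, Subgroup.mem_bot] at h2
  exact commutatorElement_eq_one_iff_mul_comm.1 h2

theorem mainTheorem6 (Γ : Subgroup (I ≃ₜ I)) (hΓ : Γ ≤ analyticDiffPlus)
    (hnonab : ¬ IsMulCommutative Γ) :
    ((∃ N : Subgroup (I ≃ₜ I), N ≤ Γ ∧ (N.subgroupOf Γ).Normal ∧ IsMulCommutative N ∧ N ≠ ⊥) →
        ¬ IsC0Discrete Γ) ∧
      (∀ N : Subgroup (I ≃ₜ I), N ≤ Γ → (N.subgroupOf Γ).Normal → IsMulCommutative N → N ≠ ⊥ →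
        ¬ IsC0Discrete N) ∧
      (Group.IsSolvable Γ → ¬ IsC0Discrete Γ) := by
  have h1 : (∃ N : Subgroup (I ≃ₜ I), N ≤ Γ ∧ (N.subgroupOf Γ).Normal ∧ IsMulCommutative N ∧
      N ≠ ⊥) → ¬ IsC0Discrete Γ := by
    rintro ⟨N, hNΓ, hnorm, hN, hne⟩ hd
    exact not_isC0Discrete_of_normal hΓ hnonab hNΓ hnorm hN hne (hd.mono hNΓ)
  refine ⟨h1, fun N hNΓ hnorm hN hne =>
    not_isC0Discrete_of_normal hΓ hnonab hNΓ hnorm hN hne, fun hsolv => h1 ?_⟩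
  have hnt : Nontrivial Γ := by
    by_contra hsub
    rw [not_nontrivial_iff_subsingleton] at hsub
    exact hnonab ⟨⟨fun a b => Subsingleton.elim _ _⟩⟩
  obtain ⟨K, hK, hKc, hKne⟩ := exists_normal_isMulCommutative_of_isSolvable (G := Γ)
  refine ⟨K.map Γ.subtype, Subgroup.map_subtype_le K, ?_, ?_, ?_⟩
  · rwa [Subgroup.subgroupOf, Subgroup.comap_map_eq_self_of_injective Γ.subtype_injective]
  · refine ⟨⟨?_⟩⟩
    rintro ⟨_, a, ha, rfl⟩ ⟨_, b, hb, rfl⟩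
    have := congrArg (fun z : K => ((z : Γ) : I ≃ₜ I)) (hKc.is_comm.comm ⟨a, ha⟩ ⟨b, hb⟩)
    exact Subtype.ext this
  · rwa [Ne, Subgroup.map_eq_bot_iff_of_injective _ Γ.subtype_injective]
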